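/- Let $(A,\mathfrak m,k)$ and $(B,\mathfrak n,l)$ be commutative local rings (not necessarily noetherian) and let $f\colon A\to B$ be a local homomorphism, i.e. $f(\mathfrak m)\subset\mathfrak n$. Let $\mathfrak a$ be an ideal of $A$ having a (possibly infinite) minimal family of generators $(x_i)_{i\in I}$, that is, a family of generators of $\mathfrak a$ whose images in $\mathfrak a/\mathfrak m\mathfrak a$ form a basis of this $k$-vector space. Let $\mathfrak b$ be an ideal of $B$ with $f(\mathfrak a)\subset\mathfrak b$, generated by the elements $f(x_i)$, $i\in I$, together with a further (possibly empty or infinite) family $(y_j)_{j\in J}$ of elements of $B$. Let $E=A\langle X_i;\ dX_i=x_i\rangle$ be the Koszul complex over $A$ on the family $(x_i)$, and $M=B\langle X_i,Y_j;\ dX_i=f(x_i),\ dY_j=y_j\rangle$ the Koszul complex over $B$ on the family consisting of the $f(x_i)$ and the $y_j$. The homomorphism of graded algebras $E\to M$ over $f$ with $X_i\mapsto X_i$ induces a canonical homomorphism of $B/\mathfrak b$-modules $$\bar\alpha\colon H_1(E)\otimes_{A/\mathfrak a}B/\mathfrak b\longrightarrow H_1(M).$$ If $\operatorname{Tor}^A_{2r}(A/\mathfrak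 a,k)=0$ for some integer $r>0$, then for every homomorphism of $B/\mathfrak b$-modules $\varphi\colon H_1(M)\to B/\mathfrak b$ one has $$\operatorname{Im}(\varphi\circ\bar\alpha)\subset\mathfrak n/\mathfrak b,$$ where $\mathfrak n/\mathfrak b$ denotes the image of $\mathfrak n$ in $B/\mathfrak b$. -/

import Mathlib

noncomputable section

namespace Koszul

open scoped TensorProduct

/-! ## The Koszul complex of a family of elements -/

section Complex

variable {R : Type*} [CommRing R] {ι : Type*}

/-- The ideal generated by a family of elements. -/
def ideal (x : ι → R) : Ideal R := Ideal.span (Set.range x)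

theorem mem_ideal (x : ι → R) (i : ι) : x i ∈ ideal x := Ideal.subset_span (Set.mem_range_self i)

/-- The linear form `R^(ι) → R` sending the `i`-th basis vector `X i` to `x i`. -/
def form (x : ι → R) : Module.Dual R (ι →₀ R) := Finsupp.linearCombination R x

/-- The differential of the Koszul complex `R⟨X i; d (X i) = x i⟩`, whose underlying graded algebra
is the exterior algebra of the free module on the symbols `X i`: it is the antiderivation of
degree `-1` (interior product) extending `form x`. -/
def d (x : ι → R) : ExteriorAlgebra R (ι →₀ R) →ₗ[R] ExteriorAlgebra R (ι →₀ R) :=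
  CliffordAlgebra.contractLeft (form x)

variable (x : ι → R)

theorem d_X (i : ι) :
    d x (ExteriorAlgebra.ι R (Finsupp.single i 1)) = algebraMap R _ (x i) := by
  refine (CliffordAlgebra.contractLeft_ι (0 : QuadraticForm R (ι →₀ R)) (form x)
    (Finsupp.single i 1)).trans ?_
  simp [form]

theorem d_ι_mul (m : ι →₀ R) (z : ExteriorAlgebra R (ι →₀ R)) :
    d x (ExteriorAlgebra.ι R m * z) = form x m • z - ExteriorAlgebra.ι R m * d x z :=
  CliffordAlgebra.contractLeft_ι_mul (Q := (0 : QuadraticForm R (ι →₀ R))) _ m z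

theorem d_d (z : ExteriorAlgebra R (ι →₀ R)) : d x (d x z) = 0 :=
  CliffordAlgebra.contractLeft_contractLeft (Q := (0 : QuadraticForm R (ι →₀ R))) _ z

theorem d_algebraMap (r : R) : d x (algebraMap R _ r) = 0 :=
  CliffordAlgebra.contractLeft_algebraMap (Q := (0 : QuadraticForm R (ι →₀ R))) _ r

theorem ι_mul_mem (n : ℕ) (m : ι →₀ R) {z : ExteriorAlgebra R (ι →₀ R)}
    (hz : z ∈ ⋀[R]^n (ι →₀ R)) : ExteriorAlgebra.ι R m * z ∈ ⋀[R]^(n + 1) (ι →₀ R) := by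
  rw [ExteriorAlgebra.exteriorPower, pow_succ']
  exact Submodule.mul_mem_mul (LinearMap.mem_range_self _ m) hz

/-- The differential lowers the degree by one. -/
theorem d_mem (n : ℕ) {z : ExteriorAlgebra R (ι →₀ R)} (hz : z ∈ ⋀[R]^(n + 1) (ι →₀ R)) :
    d x z ∈ ⋀[R]^n (ι →₀ R) := by
  induction n generalizing z with
  | zero =>
    rw [ExteriorAlgebra.exteriorPower, zero_add, pow_one] at hz
    obtain ⟨m, rfl⟩ := hz
    rw [ExteriorAlgebra.exteriorPower, pow_zero]
    exact Submodule.mem_one.mpr ⟨form x m, (CliffordAlgebra.contractLeft_ι (0 : QuadraticForm R (ι →₀ R)) (form x) m).symm⟩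
  | succ n ih =>
    rw [ExteriorAlgebra.exteriorPower, pow_succ'] at hz
    induction hz using Submodule.mul_induction_on' with
    | mem_mul_mem a ha b hb =>
      obtain ⟨m, rfl⟩ := ha
      rw [d_ι_mul]
      exact Submodule.sub_mem _ (Submodule.smul_mem _ _ hb) (ι_mul_mem n m (ih hb))
    | add a _ b _ ha hb => rw [map_add]; exact Submodule.add_mem _ ha hb

/-- The cycles of degree `n` of the Koszul complex. -/
def cycles (n : ℕ) : Submodule R (ExteriorAlgebra R (ι →₀ R)) :=
  ⋀[R]^n (ι →₀ R) ⊓ LinearMap.ker (d x)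

/-- The boundaries of degree `n` of the Koszul complex. -/
def boundaries (n : ℕ) : Submodule R (ExteriorAlgebra R (ι →₀ R)) :=
  (⋀[R]^(n + 1) (ι →₀ R)).map (d x)

theorem boundaries_le_cycles (n : ℕ) : boundaries x n ≤ cycles x n := by
  rintro _ ⟨z, hz, rfl⟩
  exact ⟨d_mem x n hz, d_d x z⟩

/-- The `n`-th Koszul homology module, cycles modulo boundaries. -/
def H (n : ℕ) : Type _ := cycles x n ⧸ (boundaries x n).submoduleOf (cycles x n)

instance (n : ℕ) : AddCommGroup (H x n) :=
  inferInstanceAs (AddCommGroup (cycles x n ⧸ (boundaries x n).submoduleOf (cycles x n)))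

instance (n : ℕ) : Module R (H x n) :=
  inferInstanceAs (Module R (cycles x n ⧸ (boundaries x n).submoduleOf (cycles x n)))

/-- The homology class of a cycle. -/
def H.mk (n : ℕ) : cycles x n →ₗ[R] H x n :=
  ((boundaries x n).submoduleOf (cycles x n)).mkQ

theorem H.mk_surjective (n : ℕ) : Function.Surjective (H.mk x n) :=
  Submodule.mkQ_surjective _

theorem H.mk_eq_zero (n : ℕ) (z : cycles x n) :
    H.mk x n z = 0 ↔ (z : ExteriorAlgebra R (ι →₀ R)) ∈ boundaries x n :=
  Submodule.Quotient.mk_eq_zero _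

/-- Koszul homology is annihilated by the ideal generated by the family. -/
theorem isTorsionBySet_H (n : ℕ) : Module.IsTorsionBySet R (H x n) (ideal x) := by
  refine (Module.isTorsionBySet_iff_is_torsion_by_span (M := H x n) (Set.range x)).mp ?_
  rintro h ⟨_, i, rfl⟩
  obtain ⟨z, rfl⟩ := H.mk_surjective x n h
  change x i • H.mk x n z = 0
  rw [← map_smul, H.mk_eq_zero]
  refine ⟨ExteriorAlgebra.ι R (Finsupp.single i (1 : R)) * z.1, ι_mul_mem n _ z.2.1, ?_⟩
  rw [d_ι_mul, LinearMap.mem_ker.mp z.2.2]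
  simp [form]

/-- The structure of `R ⧸ (x)`-module on Koszul homology. -/
instance (n : ℕ) : Module (R ⧸ ideal x) (H x n) :=
  (isTorsionBySet_H x n).module

theorem mk_smul_H (n : ℕ) (r : R) (h : H x n) :
    (Ideal.Quotient.mk (ideal x) r) • h = r • h := rfl

/-- Over a local ring, `x` is a minimal family of generators of the ideal `𝔞` it generates: the
images of the `x i` form a basis of the `R ⧸ 𝔪`-vector space `𝔞 ⧸ 𝔪𝔞`. -/
def IsMinimal [IsLocalRing R] : Prop :=
  ∃ b : Module.Basis ι (R ⧸ IsLocalRing.maximalIdeal R)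
      (ideal x ⧸ (IsLocalRing.maximalIdeal R • ⊤ : Submodule R (ideal x))),
    ∀ i, b i = Submodule.Quotient.mk ⟨x i, mem_ideal x i⟩

end Complex

/-! ## The canonical map between Koszul homology modules -/

section Comparison

variable {A B : Type*} [CommRing A] [CommRing B] [Algebra A B] {ι κ : Type*}
  (x : ι → A) (y : κ → B)

/-- The family of elements of `B` consisting of the images of the `x i` and of the `y j`. -/
def extend : ι ⊕ κ → B := Sum.elim (fun i => algebraMap A B (x i)) y

/-- The map `A^(ι) → B^(ι ⊕ κ)` sending `X i` to `X i`. -/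
def genMap (A B : Type*) [CommRing A] [CommRing B] [Algebra A B] (ι κ : Type*) :
    (ι →₀ A) →ₗ[A] (ι ⊕ κ →₀ B) :=
  Finsupp.linearCombination A (fun i => Finsupp.single (Sum.inl i) (1 : B))

/-- The homomorphism of graded algebras from `A⟨X i⟩` to `B⟨X i, Y j⟩` over `A → B`
sending `X i` to `X i`. -/
def algMap (A B : Type*) [CommRing A] [CommRing B] [Algebra A B] (ι κ : Type*) :
    ExteriorAlgebra A (ι →₀ A) →ₐ[A] ExteriorAlgebra B (ι ⊕ κ →₀ B) :=
  ExteriorAlgebra.lift A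
    ⟨((ExteriorAlgebra.ι B).restrictScalars A).comp (genMap A B ι κ),
      fun _ => ExteriorAlgebra.ι_sq_zero _⟩

theorem algMap_ι (m : ι →₀ A) :
    algMap A B ι κ (ExteriorAlgebra.ι A m) = ExteriorAlgebra.ι B (genMap A B ι κ m) :=
  ExteriorAlgebra.lift_ι_apply A _ _ m

theorem algMap_smul (a : A) (z : ExteriorAlgebra A (ι →₀ A)) :
    algMap A B ι κ (a • z) = algebraMap A B a • algMap A B ι κ z := by
  rw [map_smul, algebraMap_smul]

theorem form_genMap (m : ι →₀ A) :
    form (extend x y) (genMap A B ι κ m) = algebraMap A B (form x m) := by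
  induction m using Finsupp.induction_linear with
  | zero => simp
  | add f g hf hg => simp only [map_add, hf, hg]
  | single i a => simp [form, genMap, extend, Algebra.smul_def]

theorem algMap_mem (n : ℕ) {z : ExteriorAlgebra A (ι →₀ A)} (hz : z ∈ ⋀[A]^n (ι →₀ A)) :
    algMap A B ι κ z ∈ ⋀[B]^n (ι ⊕ κ →₀ B) := by
  induction n generalizing z with
  | zero =>
    rw [ExteriorAlgebra.exteriorPower, pow_zero] at hz ⊢
    obtain ⟨a, rfl⟩ := Submodule.mem_one.mp hz
    refine Submodule.mem_one.mpr ⟨algebraMap A B a, ?_⟩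
    rw [Algebra.algebraMap_eq_smul_one (R := A) (A := ExteriorAlgebra A (ι →₀ A)), algMap_smul,
      map_one, ← Algebra.algebraMap_eq_smul_one]
  | succ n ih =>
    rw [ExteriorAlgebra.exteriorPower, pow_succ'] at hz
    induction hz using Submodule.mul_induction_on' with
    | mem_mul_mem a ha b hb =>
      obtain ⟨m, rfl⟩ := ha
      rw [map_mul, algMap_ι]
      exact ι_mul_mem n _ (ih hb)
    | add a _ b _ ha hb => rw [map_add]; exact Submodule.add_mem _ ha hb

/-- The canonical map of Koszul algebras commutes with the differentials. -/
theorem d_algMap (z : ExteriorAlgebra A (ι →₀ A)) :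
    d (extend x y) (algMap A B ι κ z) = algMap A B ι κ (d x z) := by
  induction z using CliffordAlgebra.left_induction with
  | algebraMap r =>
    rw [d_algebraMap, map_zero]
    rw [Algebra.algebraMap_eq_smul_one, algMap_smul, map_one, ← Algebra.algebraMap_eq_smul_one,
      d_algebraMap]
  | add a b ha hb => simp only [map_add, ha, hb]
  | ι_mul z m hz =>
    change d (extend x y) (algMap A B ι κ (ExteriorAlgebra.ι A m * z)) =
      algMap A B ι κ (d x (ExteriorAlgebra.ι A m * z))
    rw [d_ι_mul, map_sub, map_mul (algMap A B ι κ), map_mul (algMap A B ι κ), algMap_smul, algMap_ι,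
      d_ι_mul, hz, form_genMap]

/-- The map induced on cycles by the canonical map of Koszul complexes. -/
def cyclesMap (n : ℕ) : cycles x n →ₛₗ[algebraMap A B] cycles (extend x y) n where
  toFun z := ⟨algMap A B ι κ z, algMap_mem n z.2.1, by
    change d (extend x y) (algMap A B ι κ z) = 0
    rw [d_algMap, LinearMap.mem_ker.mp z.2.2, map_zero]⟩
  map_add' _ _ := Subtype.ext (map_add _ _ _)
  map_smul' a z := Subtype.ext (algMap_smul (κ := κ) a z.1)

/-- The map induced on homology by the canonical map of Koszul complexes. -/
def HMap (n : ℕ) : H x n →ₛₗ[algebraMap A B] H (extend x y) n :=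
  Submodule.mapQ _ _ (cyclesMap x y n) (by
    rintro z ⟨w, hw, hwz⟩
    refine ⟨algMap A B ι κ w, algMap_mem _ hw, ?_⟩
    exact (d_algMap x y w).trans (congrArg (algMap A B ι κ) hwz))

theorem HMap_mk (n : ℕ) (z : cycles x n) :
    HMap x y n (H.mk x n z) = H.mk (extend x y) n (cyclesMap x y n z) := rfl

theorem ideal_le_comap : ideal x ≤ (ideal (extend x y)).comap (algebraMap A B) := by
  refine Ideal.span_le.mpr ?_
  rintro _ ⟨i, rfl⟩
  exact Ideal.subset_span ⟨Sum.inl i, rfl⟩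

/-- `B ⧸ 𝔟` as an algebra over `A ⧸ 𝔞` through the given homomorphism `A → B`. -/
instance : Algebra (A ⧸ ideal x) (B ⧸ ideal (extend x y)) :=
  Ideal.Quotient.algebraQuotientOfLEComap (ideal_le_comap x y)

/-- Koszul homology over `B` as an `A ⧸ 𝔞`-module, by restriction of scalars along
`A ⧸ 𝔞 → B ⧸ 𝔟`. -/
instance (n : ℕ) : Module (A ⧸ ideal x) (H (extend x y) n) :=
  Module.compHom _ (algebraMap (A ⧸ ideal x) (B ⧸ ideal (extend x y)))

instance (n : ℕ) :
    IsScalarTower (A ⧸ ideal x) (B ⧸ ideal (extend x y)) (H (extend x y) n) :=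
  IsScalarTower.of_algebraMap_smul fun _ _ => rfl

/-- The map induced on Koszul homology, as a homomorphism of `A ⧸ 𝔞`-modules. -/
def HMapQuot (n : ℕ) : H x n →ₗ[A ⧸ ideal x] H (extend x y) n where
  toFun := HMap x y n
  map_add' := map_add _
  map_smul' c h := by
    obtain ⟨a, rfl⟩ := Ideal.Quotient.mk_surjective c
    exact (HMap x y n).map_smulₛₗ a h

/-- The canonical homomorphism `(B ⧸ 𝔟) ⊗ H_n(E) → H_n(M)`, the tensor product being over `A ⧸ 𝔞`:
the `B ⧸ 𝔟`-linear extension `c ⊗ h ↦ c • (image of h)` of the map induced on homology by the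
canonical map of Koszul complexes `E → M`. -/
def alphaBar (n : ℕ) :
    (B ⧸ ideal (extend x y)) ⊗[A ⧸ ideal x] H x n →ₗ[B ⧸ ideal (extend x y)]
      H (extend x y) n :=
  (HMapQuot x y n).liftBaseChange (B ⧸ ideal (extend x y))

theorem alphaBar_tmul (n : ℕ) (c : B ⧸ ideal (extend x y)) (h : H x n) :
    alphaBar x y n (c ⊗ₜ h) = c • HMap x y n h :=
  LinearMap.liftBaseChange_tmul _ _ _ _

end Comparison

end Koszul

end

/-! Linearity reduces the claim to the class of one relation `w` of `x`, whose coefficients lie in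
`𝔪` by minimality. If `𝔟 = B` the target is zero, so assume `𝔟 ⊆ 𝔫` and suppose that `φ` takes a
value `u` on that class which is a unit.

Two differential modules are compared. Adjoining to `E` a divided power variable `S` of degree 2
with `dS = w` gives the free complex `E⟨S⟩` over `A ⧸ 𝔞`. Pushing the relations over `B` forward
along `φ` gives an extension `B ⧸ 𝔟 → B^(ι ⊕ κ) ⧸ ker φ → B → B ⧸ 𝔟`; since `u` is a unit, splicing
it with itself through `w` gives an exact 2-periodic complex `V` (`mem_range_dPeriodic`). The map
`E⟨S⟩ → V` that keeps only the constant and linear parts of the coefficient of each `S⁽ᵏ⁾` is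
compatible with the differentials (`dPeriodic_comparison`) and sends `S⁽ʳ⁾` to `1 ∈ B`.

Up to homotopy this map factors through a projective resolution `P` of `A ⧸ 𝔞`. As `dS⁽ʳ⁾ = w
S⁽ʳ⁻¹⁾` is zero modulo `𝔪`, the image of `S⁽ʳ⁾` in `P ⊗ k` is a cycle of degree `2r`, hence a
boundary because `Tor_{2r}` vanishes. The `B`-component of a boundary of `V` lies in `𝔟 ⊆ 𝔫`, so `1
∈ 𝔫` (`mem_maximalIdeal_of_isZero_tor`), a contradiction. -/

noncomputable section

open CategoryTheory CategoryTheory.Limits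
open scoped TensorProduct

/-! ### Comparison of projective complexes with acyclic ones -/

section Lifting

variable {A : Type*} [CommRing A]

theorem exists_comp_eq_of_range_le {K P Q : Type*} [AddCommGroup K] [AddCommGroup P]
    [AddCommGroup Q] [Module A K] [Module A P] [Module A Q] [Module.Projective A K]
    (f : K →ₗ[A] P) (g : Q →ₗ[A] P) (h : ∀ k, f k ∈ LinearMap.range g) :
    ∃ l : K →ₗ[A] Q, g ∘ₗ l = f := by
  obtain ⟨l, hl⟩ := Module.projective_lifting_property g.rangeRestrict
    (f.codRestrict _ h) g.surjective_rangeRestrict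
  exact ⟨l, LinearMap.ext fun k => congrArg Subtype.val (LinearMap.congr_fun hl k)⟩

variable {K G : ℕ → Type*} [∀ n, AddCommGroup (K n)] [∀ n, AddCommGroup (G n)]
  [∀ n, Module A (K n)] [∀ n, Module A (G n)] [∀ n, Module.Projective A (K n)]
  (dK : ∀ n, K (n + 1) →ₗ[A] K n) (dG : ∀ n, G (n + 1) →ₗ[A] G n)

/-- A map in degree zero extends to a chain map from a complex of projectives to an acyclic
complex. -/
theorem exists_chainMap (hK : ∀ n k, dK n (dK (n + 1) k) = 0)
    (hG : ∀ n g, dG n g = 0 → g ∈ LinearMap.range (dG (n + 1)))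
    (c₀ : K 0 →ₗ[A] G 0) (h₀ : ∀ k, c₀ (dK 0 k) ∈ LinearMap.range (dG 0)) :
    ∃ c : ∀ n, K n →ₗ[A] G n, c 0 = c₀ ∧ ∀ n k, dG n (c (n + 1) k) = c n (dK n k) := by
  have step : ∀ n (c : K n →ₗ[A] G n), (∀ k, c (dK n k) ∈ LinearMap.range (dG n)) →
      ∃ c' : K (n + 1) →ₗ[A] G (n + 1), dG n ∘ₗ c' = c ∘ₗ dK n :=
    fun n c hc => exists_comp_eq_of_range_le _ _ hc
  -- `choose!` makes `s` total, so the recursion can be defined before its lifting condition is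
  -- proved by induction.
  choose! s hs using step
  let c : ∀ n, K n →ₗ[A] G n := fun n => Nat.rec c₀ s n
  have hc : ∀ n k, c n (dK n k) ∈ LinearMap.range (dG n) := by
    intro n
    induction n with
    | zero => exact h₀
    | succ n ih =>
      intro k
      apply hG
      change (dG n ∘ₗ s n (c n)) (dK (n + 1) k) = 0
      rw [hs n (c n) ih, LinearMap.comp_apply, hK, map_zero]
  exact ⟨c, rfl, fun n k => LinearMap.congr_fun (hs n (c n) (hc n)) k⟩

/-- A chain map from a complex of projectives to an acyclic complex that vanishes on homology in
degree zero is null-homotopic. -/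
theorem exists_homotopy (hK : ∀ n k, dK n (dK (n + 1) k) = 0)
    (hG : ∀ n g, dG n g = 0 → g ∈ LinearMap.range (dG (n + 1)))
    (c : ∀ n, K n →ₗ[A] G n) (hc : ∀ n k, dG n (c (n + 1) k) = c n (dK n k))
    (h₀ : ∀ k, c 0 k ∈ LinearMap.range (dG 0)) :
    ∃ h : ∀ n, K n →ₗ[A] G (n + 1),
      ∀ n k, c (n + 1) k = dG (n + 1) (h (n + 1) k) + h n (dK n k) := by
  obtain ⟨s₀, hs₀⟩ := exists_comp_eq_of_range_le (c 0) (dG 0) h₀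
  have step : ∀ n (h : K n →ₗ[A] G (n + 1)),
      (∀ k, (c (n + 1) - h ∘ₗ dK n) k ∈ LinearMap.range (dG (n + 1))) →
      ∃ h' : K (n + 1) →ₗ[A] G (n + 2), dG (n + 1) ∘ₗ h' = c (n + 1) - h ∘ₗ dK n :=
    fun n h hh => exists_comp_eq_of_range_le _ _ hh
  choose! s hs using step
  let h : ∀ n, K n →ₗ[A] G (n + 1) := fun n => Nat.rec s₀ s n
  have hh : ∀ n k, (c (n + 1) - h n ∘ₗ dK n) k ∈ LinearMap.range (dG (n + 1)) := by
    intro n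
    induction n with
    | zero =>
      intro k
      apply hG
      rw [LinearMap.sub_apply, map_sub, hc, LinearMap.comp_apply]
      change _ - (dG 0 ∘ₗ s₀) _ = 0
      rw [hs₀, sub_self]
    | succ n ih =>
      intro k
      apply hG
      rw [LinearMap.sub_apply, map_sub, hc, LinearMap.comp_apply]
      change _ - (dG (n + 1) ∘ₗ s n (h n)) _ = 0
      rw [hs n (h n) ih, LinearMap.sub_apply, LinearMap.comp_apply, hK, map_zero, sub_zero,
        sub_self]
  refine ⟨h, fun n k => ?_⟩
  have := LinearMap.congr_fun (hs n (h n) (hh n)) k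
  rw [LinearMap.sub_apply, LinearMap.comp_apply, LinearMap.comp_apply, eq_sub_iff_add_eq] at this
  exact this.symm

end Lifting

/-! ### Projective resolutions of modules and vanishing of Tor -/

section Tor

universe u

variable {A : Type u} [CommRing A] {M : ModuleCat.{u} A} (P : ProjectiveResolution M)

theorem CategoryTheory.ProjectiveResolution.module_projective (n : ℕ) :
    Module.Projective A (P.complex.X n) :=
  (IsProjective.iff_projective _).mpr (P.projective n)

theorem CategoryTheory.ProjectiveResolution.d_d_apply (n : ℕ) (q : P.complex.X (n + 2)) :
    (P.complex.d (n + 1) n).hom ((P.complex.d (n + 2) (n + 1)).hom q) = 0 := by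
  rw [← ModuleCat.comp_apply, P.complex.d_comp_d]; rfl

theorem CategoryTheory.ProjectiveResolution.mem_range_d (n : ℕ) (q : P.complex.X (n + 1))
    (hq : (P.complex.d (n + 1) n).hom q = 0) :
    q ∈ LinearMap.range (P.complex.d (n + 2) (n + 1)).hom :=
  (ShortComplex.moduleCat_exact_iff _).mp (P.exact_succ n) q hq

/-- The augmentation of a projective resolution. -/
def CategoryTheory.ProjectiveResolution.augmentation : P.complex.X 0 →ₗ[A] M :=
  (P.π.f 0 ≫ (HomologicalComplex.singleObjXSelf (.down ℕ) 0 M).hom).hom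

theorem CategoryTheory.ProjectiveResolution.augmentation_surjective :
    Function.Surjective P.augmentation :=
  (ModuleCat.epi_iff_surjective
    (P.π.f 0 ≫ (HomologicalComplex.singleObjXSelf (.down ℕ) 0 M).hom)).mp inferInstance

theorem CategoryTheory.ProjectiveResolution.augmentation_d (q : P.complex.X 1) :
    P.augmentation ((P.complex.d 1 0).hom q) = 0 := by
  have h := P.complex_d_comp_π_f_zero
  have h2 : P.complex.d 1 0 ≫ P.π.f 0 ≫ (HomologicalComplex.singleObjXSelf (.down ℕ) 0 M).hom
    = 0 := by rw [← Category.assoc, h, zero_comp]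
  exact LinearMap.congr_fun (congrArg ModuleCat.Hom.hom h2) q

theorem CategoryTheory.ProjectiveResolution.mem_range_d_zero (q : P.complex.X 0)
    (hq : P.augmentation q = 0) : q ∈ LinearMap.range (P.complex.d 1 0).hom := by
  have := (ShortComplex.moduleCat_exact_iff _).mp P.exact₀ q
  refine this ?_
  have hq' : (HomologicalComplex.singleObjXSelf (.down ℕ) 0 M).hom.hom (P.π.f 0 q) = 0 := hq
  exact (ModuleCat.mono_iff_injective _).mp inferInstance (hq'.trans (map_zero _).symm)

/-- If `Tor_{n+1}(M, Y)` vanishes, the tensor product with `Y` of a projective resolution of `M` is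
exact in degree `n + 1`. -/
theorem CategoryTheory.ProjectiveResolution.mem_range_rTensor_of_isZero_tor (Y : ModuleCat.{u} A)
    (n : ℕ) (h : IsZero (((Tor' (ModuleCat A) (n + 1)).obj M).obj Y))
    (t : P.complex.X (n + 1) ⊗[A] Y)
    (ht : (P.complex.d (n + 1) n).hom.rTensor Y t = 0) :
    t ∈ LinearMap.range ((P.complex.d (n + 2) (n + 1)).hom.rTensor Y) := by
  -- `Tor'` derives the first factor, so a resolution of `M` tensored with `Y` computes it.
  let F := MonoidalCategory.tensoringRight (ModuleCat A) |>.obj Y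
  have e := P.isoLeftDerivedObj F (n + 1)
  have h0 : IsZero (((F.mapHomologicalComplex _).obj P.complex).homology (n + 1)) :=
    IsZero.of_iso h e.symm
  have hex := (HomologicalComplex.exactAt_iff_isZero_homology _ _).mpr h0
  rw [HomologicalComplex.exactAt_iff' _ (n + 2) (n + 1) n (by simp) (by simp),
    ShortComplex.moduleCat_exact_iff] at hex
  exact hex t ht

end Tor

namespace Koszul

/-! ### Constant and linear parts in the exterior algebra -/

section LowDegree

variable {A : Type*} [CommRing A] {ι : Type*}

theorem projective_exteriorAlgebra (M : Type*) [AddCommGroup M] [Module A M] [Module.Free A M] :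
    Module.Projective A (ExteriorAlgebra A M) := by
  obtain ⟨I, b⟩ := Module.Free.exists_basis A M
  classical
  let : LinearOrder I := linearOrderOfSTO WellOrderingRel
  exact Module.Projective.of_basis b.ExteriorAlgebra

/-- `ιInv` is the second component of a map to the trivial square-zero extension, where `(0, m) *
(a, n) = (0, a • m)`. -/
theorem ιInv_ι_mul {M : Type*} [AddCommGroup M] [Module A M] (m : M) (z : ExteriorAlgebra A M) :
    ExteriorAlgebra.ιInv (ExteriorAlgebra.ι A m * z) = ExteriorAlgebra.algebraMapInv z • m := by
  -- The algebra structure on the trivial square-zero extension needs a right action, taken equal to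
  -- the left one.
  let : Module Aᵐᵒᵖ M := Module.compHom _ ((RingHom.id A).fromOpposite mul_comm)
  have : IsCentralScalar A M := ⟨fun r m => rfl⟩
  have h : ∀ z : ExteriorAlgebra A M,
      (ExteriorAlgebra.toTrivSqZeroExt z).fst = ExteriorAlgebra.algebraMapInv z := by
    intro z
    have : (TrivSqZeroExt.fstHom A A M).comp ExteriorAlgebra.toTrivSqZeroExt =
        ExteriorAlgebra.algebraMapInv := by
      apply ExteriorAlgebra.hom_ext
      ext m
      simp [ExteriorAlgebra.algebraMapInv]
    exact DFunLike.congr_fun this z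
  simp [ExteriorAlgebra.ιInv, h]

theorem algebraMapInv_ι_mul {M : Type*} [AddCommGroup M] [Module A M] (m : M)
    (z : ExteriorAlgebra A M) :
    ExteriorAlgebra.algebraMapInv (ExteriorAlgebra.ι A m * z) = 0 := by
  simp [ExteriorAlgebra.algebraMapInv]

theorem ιInv_algebraMap {M : Type*} [AddCommGroup M] [Module A M] (a : A) :
    ExteriorAlgebra.ιInv (algebraMap A (ExteriorAlgebra A M) a) = 0 := by
  simp [ExteriorAlgebra.ιInv]
  rfl

variable (x : ι → A)

theorem algebraMapInv_d (z : ExteriorAlgebra A (ι →₀ A)) :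
    ExteriorAlgebra.algebraMapInv (d x z) = form x (ExteriorAlgebra.ιInv z) := by
  induction z using CliffordAlgebra.left_induction with
  | algebraMap r =>
    rw [d_algebraMap, map_zero]
    exact ((congrArg (form x) (ιInv_algebraMap r)).trans (map_zero _)).symm
  | add a b ha hb => simp only [map_add, ha, hb]
  | ι_mul z m hz =>
    change ExteriorAlgebra.algebraMapInv (d x (ExteriorAlgebra.ι A m * z)) =
      form x (ExteriorAlgebra.ιInv (ExteriorAlgebra.ι A m * z))
    rw [d_ι_mul, map_sub, algebraMapInv_ι_mul, ιInv_ι_mul, map_smul, map_smul, sub_zero,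
      smul_eq_mul, smul_eq_mul, mul_comm]

/-- The linear part of `d z` depends only on the quadratic part of `z`. For a product `m * z` this
part is `m * z₁`, with `z₁` the linear part of `z`, and it serves as the witness. -/
theorem ι_ιInv_d_mem_boundaries (z : ExteriorAlgebra A (ι →₀ A)) :
    ExteriorAlgebra.ι A (ExteriorAlgebra.ιInv (d x z)) ∈ boundaries x 1 := by
  induction z using CliffordAlgebra.left_induction with
  | algebraMap r => rw [d_algebraMap, map_zero, map_zero]; exact zero_mem _
  | add a b ha hb => simp only [map_add]; exact add_mem ha hb
  | ι_mul z m hz =>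
    change ExteriorAlgebra.ι A (ExteriorAlgebra.ιInv (d x (ExteriorAlgebra.ι A m * z))) ∈ _
    have h1 : ∀ v : ι →₀ A, ExteriorAlgebra.ι A v ∈ ⋀[A]^1 (ι →₀ A) := fun v => by
      rw [ExteriorAlgebra.exteriorPower, pow_one]; exact ⟨v, rfl⟩
    refine ⟨ExteriorAlgebra.ι A m * ExteriorAlgebra.ι A (ExteriorAlgebra.ιInv z),
      ι_mul_mem 1 m (h1 _), ?_⟩
    have h2 : d x (ExteriorAlgebra.ι A (ExteriorAlgebra.ιInv z)) =
        algebraMap A _ (form x (ExteriorAlgebra.ιInv z)) :=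
      CliffordAlgebra.contractLeft_ι (0 : QuadraticForm A (ι →₀ A)) (form x) _
    rw [d_ι_mul, h2, d_ι_mul, map_sub, ιInv_ι_mul, algebraMapInv_d, map_sub, map_smul, map_smul,
      map_smul, ← Algebra.commutes, Algebra.smul_def (form x (ExteriorAlgebra.ιInv z))]

end LowDegree

/-! ### Adjoining a divided power variable that kills a cycle -/

section Adjunction

variable {A : Type*} [CommRing A] {ι : Type*} (x : ι → A) (w : ι →₀ A)

/-- The differential of `E⟨S; dS = ι w⟩`, the Koszul complex with a divided power variable
adjoined: the coefficient of `S⁽ⁿ⁾` is the value at `n`. -/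
def dDivided : (ℕ →₀ ExteriorAlgebra A (ι →₀ A)) →ₗ[A] (ℕ →₀ ExteriorAlgebra A (ι →₀ A)) :=
  Finsupp.mapRange.linearMap (d x) +
    (Finsupp.mapRange.linearMap (LinearMap.mulLeft A (ExteriorAlgebra.ι A w))).comp
      (Finsupp.lcomapDomain Nat.succ Nat.succ_injective)

theorem dDivided_apply (f : ℕ →₀ ExteriorAlgebra A (ι →₀ A)) (n : ℕ) :
    dDivided x w f n = d x (f n) + ExteriorAlgebra.ι A w * f (n + 1) := rfl

/-- The cross terms cancel because `d` anticommutes with multiplication by the cycle `w`; the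
remaining term contains `w * w = 0`. -/
theorem dDivided_dDivided (hw : form x w = 0) (f : ℕ →₀ ExteriorAlgebra A (ι →₀ A)) :
    dDivided x w (dDivided x w f) = 0 := by
  ext1 n
  rw [dDivided_apply, dDivided_apply, dDivided_apply, map_add, d_d, d_ι_mul, hw, mul_add,
    ← mul_assoc, ExteriorAlgebra.ι_sq_zero]
  simp

/-- Divided powers leave no factor `n + 1` here, which is what lets every `S⁽ⁿ⁾` map to `1` in the
periodic complex. -/
theorem dDivided_single (n : ℕ) :
    dDivided x w (Finsupp.single (n + 1) 1) = Finsupp.single n (ExteriorAlgebra.ι A w) := by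
  ext1 m
  rw [dDivided_apply]
  have h : d x (1 : ExteriorAlgebra A (ι →₀ A)) = 0 := by simpa using d_algebraMap x 1
  rcases eq_or_ne m n with rfl | hm
  · rw [Finsupp.single_eq_of_ne (by simp)]; simp
  · rw [Finsupp.single_apply, Finsupp.single_eq_of_ne (by omega), Finsupp.single_eq_of_ne hm]
    split_ifs <;> simp [h]

end Adjunction

/-! ### Relations of a minimal family -/

section Minimal

/-- Modulo `𝔪` the relation becomes a linear relation between basis vectors of `𝔞 ⧸ 𝔪𝔞`. -/
theorem IsMinimal.mem_maximalIdeal {A : Type*} [CommRing A] [IsLocalRing A] {ι : Type*}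
    {x : ι → A} (hx : IsMinimal x) (w : ι →₀ A) (hw : form x w = 0) (i : ι) :
    w i ∈ IsLocalRing.maximalIdeal A := by
  obtain ⟨b, hb⟩ := hx
  have h : w.sum (fun i a => Ideal.Quotient.mk (IsLocalRing.maximalIdeal A) a • b i) = 0 := by
    have h1 : w.sum (fun i a => a • (⟨x i, mem_ideal x i⟩ : ideal x)) = 0 := by
      apply Subtype.ext
      rw [Finsupp.sum, AddSubmonoidClass.coe_finsetSum]
      exact hw
    have h2 := congrArg (Submodule.mkQ
      (IsLocalRing.maximalIdeal A • ⊤ : Submodule A (ideal x))) h1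
    rw [map_zero, Finsupp.sum, map_sum] at h2
    rw [Finsupp.sum, ← h2]
    refine Finset.sum_congr rfl fun i _ => ?_
    rw [hb]
    rfl
  let w' : ι →₀ A ⧸ IsLocalRing.maximalIdeal A := w.mapRange (Ideal.Quotient.mk _) (map_zero _)
  have h3 : Finsupp.linearCombination _ b w' = 0 := by
    rw [← h, Finsupp.linearCombination_apply, Finsupp.sum_mapRange_index (by simp)]
  have h4 := DFunLike.congr_fun (linearIndependent_iff.mp b.linearIndependent w' h3) i
  exact Ideal.Quotient.eq_zero_iff_mem.mp h4

end Minimal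

end Koszul

namespace Koszul

theorem ι_mem_cycles {B : Type*} [CommRing B] {ι : Type*} {x : ι → B} {f : ι →₀ B}
    (hf : form x f = 0) : ExteriorAlgebra.ι B f ∈ cycles x 1 := by
  refine ⟨by rw [ExteriorAlgebra.exteriorPower, pow_one]; exact ⟨f, rfl⟩, ?_⟩
  refine (CliffordAlgebra.contractLeft_ι (0 : QuadraticForm B (ι →₀ B)) (form x) f).trans ?_
  rw [hf, map_zero]

/-! ### The two-periodic complex attached to a linear form on `H₁` -/

section Periodic

variable {B : Type*} [CommRing B] {ι : Type*} {x : ι → B}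
  (φ : H x 1 →ₗ[B ⧸ ideal x] B ⧸ ideal x)

/-- The linear form on relations induced by a linear form on the first Koszul homology. -/
def relForm : LinearMap.ker (form x) →ₗ[B] B ⧸ ideal x where
  toFun f := φ (H.mk x 1 ⟨ExteriorAlgebra.ι B f.1, ι_mem_cycles f.2⟩)
  map_add' f g := by
    rw [← map_add, ← map_add]
    refine congrArg (fun z => φ (H.mk x 1 z)) (Subtype.ext ?_)
    exact map_add (ExteriorAlgebra.ι B) f.1 g.1
  map_smul' b f := by
    have h : (⟨ExteriorAlgebra.ι B (b • f).1, ι_mem_cycles (b • f).2⟩ : cycles x 1) =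
        b • ⟨ExteriorAlgebra.ι B f.1, ι_mem_cycles f.2⟩ :=
      Subtype.ext (map_smul (ExteriorAlgebra.ι B) b f.1)
    rw [h, map_smul, ← mk_smul_H, map_smul]
    rfl

theorem relForm_smul (b : B) (f : LinearMap.ker (form x)) :
    relForm φ (b • f) = Ideal.Quotient.mk (ideal x) b * relForm φ f := by
  rw [map_smul, Algebra.smul_def, Ideal.Quotient.algebraMap_eq]

/-- The relations killed by `relForm`. -/
def relKer : Submodule B (ι →₀ B) :=
  (LinearMap.ker (relForm φ)).map (LinearMap.ker (form x)).subtype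

theorem mem_relKer {f : ι →₀ B} (hf : f ∈ LinearMap.ker (form x)) : f ∈ relKer φ ↔ relForm φ ⟨f, hf⟩ = 0 := by
  constructor
  · rintro ⟨g, hg, rfl⟩
    exact hg
  · exact fun h => ⟨⟨f, hf⟩, h, rfl⟩

/-- The map induced by `form x` on the quotient by `relKer`. -/
def formQuot : ((ι →₀ B) ⧸ relKer φ) →ₗ[B] B :=
  (relKer φ).liftQ (form x) (by
    rintro _ ⟨g, -, rfl⟩
    exact g.2)

theorem formQuot_mk (f : ι →₀ B) : formQuot φ ((relKer φ).mkQ f) = form x f := rfl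

/-- The differential of the two-periodic complex that splices the Yoneda extension
`B ⧸ (x) → B^(ι) ⧸ relKer φ → B → B ⧸ (x)` with itself. -/
def dPeriodic (w : ι →₀ B) :
    B × ((ι →₀ B) ⧸ relKer φ) →ₗ[B] B × ((ι →₀ B) ⧸ relKer φ) :=
  (formQuot φ ∘ₗ LinearMap.snd B _ _).prod
    (LinearMap.toSpanSingleton B _ ((relKer φ).mkQ w) ∘ₗ LinearMap.fst B _ _)

theorem dPeriodic_apply (w : ι →₀ B) (p : B × ((ι →₀ B) ⧸ relKer φ)) :
    dPeriodic φ w p = (formQuot φ p.2, p.1 • (relKer φ).mkQ w) := rfl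

theorem range_form : LinearMap.range (form x) = ideal x :=
  Finsupp.range_linearCombination B

theorem dPeriodic_fst_mem (w : ι →₀ B) (p : B × ((ι →₀ B) ⧸ relKer φ)) :
    (dPeriodic φ w p).1 ∈ ideal x := by
  obtain ⟨f, hf⟩ := Submodule.mkQ_surjective _ p.2
  rw [dPeriodic_apply, ← hf, formQuot_mk, ← range_form]
  exact ⟨f, rfl⟩

theorem mk_mem_range_dPeriodic (w : ι →₀ B) {b : B} (hb : b ∈ ideal x) :
    (b, 0) ∈ LinearMap.range (dPeriodic φ w) := by
  rw [← range_form] at hb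
  obtain ⟨f, rfl⟩ := hb
  exact ⟨(0, (relKer φ).mkQ f), by rw [dPeriodic_apply, formQuot_mk, zero_smul]⟩

/-- For a cycle `(b, f)`, the condition `b • w ∈ relKer φ` says that `b` times a unit vanishes
modulo `(x)`, so `b = form x g` for some `g`. Moreover `f` is a relation, and since the value at `w`
is a unit, `f` is a multiple of `w` modulo `relKer φ`. -/
theorem mem_range_dPeriodic (w : ι →₀ B) (hw : w ∈ LinearMap.ker (form x))
    (hu : IsUnit (relForm φ ⟨w, hw⟩))
    (p : B × ((ι →₀ B) ⧸ relKer φ)) (hp : dPeriodic φ w p = 0) :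
    p ∈ LinearMap.range (dPeriodic φ w) := by
  obtain ⟨b, m⟩ := p
  obtain ⟨f, rfl⟩ := Submodule.mkQ_surjective _ m
  rw [dPeriodic_apply, Prod.mk_eq_zero, formQuot_mk] at hp
  obtain ⟨hf, hb⟩ := hp
  replace hf : f ∈ LinearMap.ker (form x) := hf
  have hb' : b ∈ ideal x := by
    have h1 : b • w ∈ LinearMap.ker (form x) := Submodule.smul_mem _ b hw
    have h2 : relForm φ ⟨b • w, h1⟩ = 0 := by
      rw [← mem_relKer]
      exact (Submodule.Quotient.mk_eq_zero _).mp hb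
    have h3 : Ideal.Quotient.mk (ideal x) b * relForm φ ⟨w, hw⟩ = 0 := by
      rw [← relForm_smul]
      exact h2
    exact Ideal.Quotient.eq_zero_iff_mem.mp (hu.mul_left_eq_zero.mp h3)
  obtain ⟨g, hg⟩ : b ∈ LinearMap.range (form x) := by rwa [range_form]
  obtain ⟨c, hc⟩ := hu.exists_left_inv
  -- `b₀` lifts the quotient of the values of `relForm φ` at `f` and at `w`, so that `b₀ • w - f` is
  -- killed.
  obtain ⟨b₀, hb₀⟩ := Ideal.Quotient.mk_surjective (c * relForm φ ⟨f, hf⟩)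
  refine ⟨(b₀, (relKer φ).mkQ g), ?_⟩
  rw [dPeriodic_apply, formQuot_mk, hg, ← map_smul]
  refine congrArg (Prod.mk b) ?_
  rw [← sub_eq_zero, ← map_sub]
  refine (Submodule.Quotient.mk_eq_zero _).mpr ?_
  have h1 : b₀ • w - f ∈ LinearMap.ker (form x) :=
    Submodule.sub_mem _ (Submodule.smul_mem _ b₀ hw) hf
  rw [mem_relKer φ h1]
  have h2 : (⟨b₀ • w - f, h1⟩ : LinearMap.ker (form x)) = b₀ • ⟨w, hw⟩ - ⟨f, hf⟩ := rfl
  refine (congrArg _ h2).trans ((map_sub (relForm φ) _ _).trans ?_)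
  rw [relForm_smul, hb₀, mul_right_comm, hc, one_mul, sub_self]

end Periodic

/-! ### The comparison map from `E⟨S⟩` to the periodic complex -/

section Comparison

variable {A B : Type*} [CommRing A] [CommRing B] [Algebra A B] {ι κ : Type*} {x : ι → A}
  {y : κ → B} (φ : H (extend x y) 1 →ₗ[B ⧸ ideal (extend x y)] B ⧸ ideal (extend x y))

theorem relForm_genMap (f : ι →₀ A) (hf : form x f = 0)
    (hf' : genMap A B ι κ f ∈ LinearMap.ker (form (extend x y))) :
    relForm φ ⟨genMap A B ι κ f, hf'⟩ =
      φ (HMap x y 1 (H.mk x 1 ⟨ExteriorAlgebra.ι A f, ι_mem_cycles hf⟩)) := by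
  rw [HMap_mk]
  exact congrArg (fun z => φ (H.mk (extend x y) 1 z)) (Subtype.ext (algMap_ι f).symm)

/-- The linear part of a boundary is again a boundary, so its class in `H₁` is zero. This allows the
comparison map to discard the part of `E` of degree at least two. -/
theorem genMap_ιInv_d_mem (z : ExteriorAlgebra A (ι →₀ A)) :
    genMap A B ι κ (ExteriorAlgebra.ιInv (d x z)) ∈ relKer φ := by
  have h : form x (ExteriorAlgebra.ιInv (d x z)) = 0 := by rw [← algebraMapInv_d, d_d, map_zero]
  have h' : genMap A B ι κ (ExteriorAlgebra.ιInv (d x z)) ∈ LinearMap.ker (form (extend x y)) := by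
    rw [LinearMap.mem_ker, form_genMap, h, map_zero]
  rw [mem_relKer φ h', relForm_genMap φ _ h, (H.mk_eq_zero x 1 _).mpr (ι_ιInv_d_mem_boundaries x z),
    map_zero, map_zero]

/-- The component of even degree `2k` of the comparison map from `E⟨S⟩` to the periodic complex. -/
def evenMap (k : ℕ) : (ℕ →₀ ExteriorAlgebra A (ι →₀ A)) →ₗ[A]
    B × ((ι ⊕ κ →₀ B) ⧸ relKer φ) :=
  (LinearMap.inl B B _).restrictScalars A ∘ₗ Algebra.linearMap A B ∘ₗ
    ExteriorAlgebra.algebraMapInv.toLinearMap ∘ₗ Finsupp.lapply k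

/-- The component of odd degree `2k + 1` of the comparison map from `E⟨S⟩` to the periodic
complex. -/
def oddMap (k : ℕ) : (ℕ →₀ ExteriorAlgebra A (ι →₀ A)) →ₗ[A]
    B × ((ι ⊕ κ →₀ B) ⧸ relKer φ) :=
  (LinearMap.inr B B _).restrictScalars A ∘ₗ (relKer φ).mkQ.restrictScalars A ∘ₗ
    genMap A B ι κ ∘ₗ ExteriorAlgebra.ιInv ∘ₗ Finsupp.lapply k

variable (f : ℕ →₀ ExteriorAlgebra A (ι →₀ A)) (k : ℕ)

theorem evenMap_apply :
    evenMap φ k f = (algebraMap A B (ExteriorAlgebra.algebraMapInv (f k)), 0) := rfl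

theorem oddMap_apply :
    oddMap φ k f = (0, (relKer φ).mkQ (genMap A B ι κ (ExteriorAlgebra.ιInv (f k)))) := rfl

theorem dPeriodic_oddMap (w : ι →₀ A) :
    dPeriodic φ (genMap A B ι κ w) (oddMap φ k f) = evenMap φ k (dDivided x w f) := by
  rw [oddMap_apply, dPeriodic_apply, evenMap_apply, dDivided_apply, map_add, algebraMapInv_ι_mul,
    add_zero, algebraMapInv_d, formQuot_mk, form_genMap, zero_smul]

/-- Of the two terms in the differential of `E⟨S⟩`, the linear part of `d x (f k)` dies modulo
`relKer φ`, and that of `w * f (k + 1)` is `w` times the constant part of `f (k + 1)`. -/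
theorem dPeriodic_evenMap (w : ι →₀ A) :
    dPeriodic φ (genMap A B ι κ w) (evenMap φ (k + 1) f) = oddMap φ k (dDivided x w f) := by
  have h : (relKer φ).mkQ (genMap A B ι κ (ExteriorAlgebra.ιInv (d x (f k)))) = 0 :=
    (Submodule.Quotient.mk_eq_zero _).mpr (genMap_ιInv_d_mem φ _)
  rw [evenMap_apply, dPeriodic_apply, oddMap_apply, dDivided_apply, map_add ExteriorAlgebra.ιInv,
    map_add (genMap A B ι κ), map_add (relKer φ).mkQ, h, zero_add, ιInv_ι_mul, map_zero, map_smul]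
  exact congrArg (Prod.mk 0) (algebraMap_smul B _ ((relKer φ).mkQ (genMap A B ι κ w)))

end Comparison

end Koszul

/-! ### Reduction modulo the maximal ideals -/

section SmulTop

variable {A : Type*} [CommRing A] {M : Type*} [AddCommGroup M] [Module A M]

theorem map_mem_smul_top {N : Type*} [AddCommGroup N] [Module A N] (I : Ideal A) (g : M →ₗ[A] N)
    {m : M} (hm : m ∈ (I • ⊤ : Submodule A M)) : g m ∈ (I • ⊤ : Submodule A N) := by
  have h := Submodule.mem_map_of_mem (f := g) hm
  rw [Submodule.map_smul''] at h
  exact Submodule.smul_mono le_rfl le_top h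

theorem Finsupp.mem_smul_top {ι : Type*} (I : Ideal A) (w : ι →₀ A) (hw : ∀ i, w i ∈ I) :
    w ∈ (I • ⊤ : Submodule A (ι →₀ A)) := by
  rw [← Finsupp.sum_single w]
  refine Submodule.sum_mem _ fun i _ => ?_
  rw [← mul_one (w i), ← smul_eq_mul, ← Finsupp.smul_single]
  exact Submodule.smul_mem_smul (hw i) trivial

end SmulTop

section Residue

variable {A : Type*} [CommRing A] [IsLocalRing A] {M : Type*} [AddCommGroup M] [Module A M]

theorem tmul_residue_one_eq_zero {m : M}
    (hm : m ∈ (IsLocalRing.maximalIdeal A • ⊤ : Submodule A M)) :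
    m ⊗ₜ[A] (1 : IsLocalRing.ResidueField A) = 0 := by
  refine Submodule.smul_induction_on hm (fun a ha m _ => ?_) fun a b ha hb => ?_
  · have h : a • (1 : IsLocalRing.ResidueField A) = 0 := by
      rw [Algebra.smul_def, mul_one]
      exact (IsLocalRing.residue_eq_zero_iff a).mpr ha
    rw [TensorProduct.smul_tmul, h, TensorProduct.tmul_zero]
  · rw [TensorProduct.add_tmul, ha, hb, add_zero]

variable {B : Type*} [CommRing B] [IsLocalRing B] [Algebra A B] [IsLocalHom (algebraMap A B)]

theorem mem_maximalIdeal_of_smul_top {m : B}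
    (hm : m ∈ (IsLocalRing.maximalIdeal A • ⊤ : Submodule A B)) :
    m ∈ IsLocalRing.maximalIdeal B := by
  refine Submodule.smul_induction_on hm (fun a ha m _ => ?_) fun a b ha hb => add_mem ha hb
  · rw [Algebra.smul_def]
    refine Ideal.mul_mem_right _ _ ?_
    rw [IsLocalRing.mem_maximalIdeal, mem_nonunits_iff] at ha ⊢
    exact fun h => ha (isUnit_of_map_unit _ _ h)

/-- If `q ⊗ 1` is in the image of `d ⊗ k`, then a linear form on the target of `d` that maps the
image of `d` into the maximal ideal also maps `q` into the maximal ideal. -/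
theorem mem_maximalIdeal_of_tmul_mem_range {N : Type*} [AddCommGroup N] [Module A N]
    (δ : N →ₗ[A] M) (g : M →ₗ[A] B) (hg : ∀ n, g (δ n) ∈ IsLocalRing.maximalIdeal B) (q : M)
    (hq : q ⊗ₜ[A] (1 : IsLocalRing.ResidueField A) ∈
      LinearMap.range (δ.rTensor (IsLocalRing.ResidueField A))) :
    g q ∈ IsLocalRing.maximalIdeal B := by
  -- The reduction of `g` modulo `𝔫` extends to `M ⊗ k`, where it kills the image of `δ ⊗ k` by
  -- `hg`.
  let L : M ⊗[A] IsLocalRing.ResidueField A →ₗ[A] IsLocalRing.ResidueField B :=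
    TensorProduct.lift ((LinearMap.mul A (IsLocalRing.ResidueField B)).compl₁₂
      (Algebra.linearMap B (IsLocalRing.ResidueField B) |>.restrictScalars A |>.comp g)
      (IsScalarTower.toAlgHom A (IsLocalRing.ResidueField A)
        (IsLocalRing.ResidueField B)).toLinearMap)
  have hL : ∀ m c, L (m ⊗ₜ c) = IsLocalRing.residue B (g m) *
    algebraMap (IsLocalRing.ResidueField A) (IsLocalRing.ResidueField B) c := fun _ _ => rfl
  have h0 : ∀ u, L (δ.rTensor (IsLocalRing.ResidueField A) u) = 0 := by
    intro u
    induction u using TensorProduct.induction_on with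
    | zero => rw [map_zero, map_zero]
    | tmul n c =>
      rw [LinearMap.rTensor_tmul, hL, (IsLocalRing.residue_eq_zero_iff _).mpr (hg n), zero_mul]
    | add a b ha hb => rw [map_add, map_add, ha, hb, add_zero]
  obtain ⟨u, hu⟩ := hq
  have h1 := h0 u
  rw [hu, hL, map_one, mul_one] at h1
  exact (IsLocalRing.residue_eq_zero_iff _).mp h1

end Residue

-- Factoring through a resolution when Tor vanishes

universe u

/-- Let `K` be a projective module with a differential `D` and `V` an acyclic differential module
over a local ring `A`. If `Tor_{n+1}(M, k)` vanishes, then a map of differential modules `K → V`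
that factors in degree zero through `M` takes in degree `n + 1` each element whose differential
lies in `𝔪K` into the maximal ideal of `B`, up to boundaries. -/
theorem mem_maximalIdeal_of_isZero_tor {A : Type u} {B : Type*} [CommRing A] [IsLocalRing A]
    [CommRing B] [IsLocalRing B] [Algebra A B] [IsLocalHom (algebraMap A B)] (M : ModuleCat.{u} A)
    (n : ℕ) (hTor : IsZero (((Tor' (ModuleCat A) (n + 1)).obj M).obj
      (ModuleCat.of A (IsLocalRing.ResidueField A))))
    {K V : Type*} [AddCommGroup K] [Module A K] [Module.Projective A K] [AddCommGroup V]
    [Module A V] (D : K →ₗ[A] K) (hD : ∀ k, D (D k) = 0) (δ : V →ₗ[A] V)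
    (hδ : ∀ v, δ v = 0 → v ∈ LinearMap.range δ)
    (e : ℕ → K →ₗ[A] V) (he : ∀ n k, δ (e (n + 1) k) = e n (D k))
    (ε : K →ₗ[A] M) (hε : ∀ k, ε (D k) = 0) (τ : M →ₗ[A] V ⧸ LinearMap.range δ)
    (hτ : ∀ k, (LinearMap.range δ).mkQ (e 0 k) = τ (ε k))
    (g : V →ₗ[A] B) (hg : ∀ v, g (δ v) ∈ IsLocalRing.maximalIdeal B)
    (σ : K) (hσ : D σ ∈ (IsLocalRing.maximalIdeal A • ⊤ : Submodule A K)) :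
    g (e (n + 1) σ) ∈ IsLocalRing.maximalIdeal B := by
  let P := ProjectiveResolution.of M
  have hP : ∀ n, Module.Projective A (P.complex.X n) := P.module_projective
  let dP : ∀ n, P.complex.X (n + 1) →ₗ[A] P.complex.X n := fun n => (P.complex.d (n + 1) n).hom
  obtain ⟨c₀, hc₀⟩ := Module.projective_lifting_property P.augmentation ε P.augmentation_surjective
  -- A differential module is read as the complex with the same module in every degree; the grading
  -- is carried by the index of the maps.
  obtain ⟨c, rfl, hc⟩ := exists_chainMap (K := fun _ => K) (G := fun n => P.complex.X n)
    (fun _ => D) dP (fun _ => hD) P.mem_range_d c₀ fun k =>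
      P.mem_range_d_zero _ ((LinearMap.congr_fun hc₀ _).trans (hε k))
  obtain ⟨p₀, hp₀⟩ := Module.projective_lifting_property (LinearMap.range δ).mkQ
    (τ ∘ₗ P.augmentation) (Submodule.mkQ_surjective _)
  obtain ⟨p, rfl, hp⟩ := exists_chainMap (K := fun n => P.complex.X n) (G := fun _ => V) dP
    (fun _ => δ) P.d_d_apply (fun _ => hδ) p₀ fun q => by
      refine (Submodule.Quotient.mk_eq_zero _).mp ((LinearMap.congr_fun hp₀ _).trans ?_)
      exact (congrArg τ (P.augmentation_d q)).trans (map_zero τ)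
  -- Both `e` and `p ∘ c` induce `τ ∘ ε` in degree zero, so their difference is null-homotopic.
  obtain ⟨h, hh⟩ := exists_homotopy (K := fun _ => K) (G := fun _ => V) (fun _ => D) (fun _ => δ)
    (fun _ => hD) (fun _ => hδ) (fun n => e n - p n ∘ₗ c n)
    (fun n k => by
      rw [LinearMap.sub_apply, LinearMap.sub_apply, map_sub, he, LinearMap.comp_apply, hp, hc]
      rfl)
    fun k => by
      refine (Submodule.Quotient.mk_eq_zero _).mp ?_
      change (LinearMap.range δ).mkQ (e 0 k - p 0 (c 0 k)) = 0
      rw [map_sub, sub_eq_zero, hτ, ← LinearMap.congr_fun hc₀ k]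
      exact (LinearMap.congr_fun hp₀ (c 0 k)).symm
  -- The differential of `c σ` is `c (D σ) ∈ 𝔪P`, so `c σ ⊗ 1` is a cycle of `P ⊗ k`, and vanishing
  -- of Tor makes it a boundary.
  have h1 : g (p (n + 1) (c (n + 1) σ)) ∈ IsLocalRing.maximalIdeal B := by
    refine mem_maximalIdeal_of_tmul_mem_range (dP (n + 1)) (g ∘ₗ p (n + 1)) (fun q => ?_) _
      (P.mem_range_rTensor_of_isZero_tor _ _ hTor _ ?_)
    · rw [LinearMap.comp_apply, ← hp]
      exact hg _
    · refine (LinearMap.rTensor_tmul _ _ _ _).trans (tmul_residue_one_eq_zero ?_)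
      exact hc n σ ▸ map_mem_smul_top _ (c n) hσ
  have h2 : e (n + 1) σ = δ (h (n + 1) σ) + h n (D σ) + p (n + 1) (c (n + 1) σ) :=
    sub_eq_iff_eq_add.mp (hh n σ)
  rw [h2, map_add, map_add]
  exact add_mem (add_mem (hg _)
    (mem_maximalIdeal_of_smul_top (map_mem_smul_top _ (g ∘ₗ h n) hσ))) h1

namespace Koszul

/-! ### The class of the divided power as an obstruction -/

section Obstruction

variable {A : Type*} {B : Type*} [CommRing A] [CommRing B] [Algebra A B] {ι κ : Type*}
  {x : ι → A} {y : κ → B} (φ : H (extend x y) 1 →ₗ[B ⧸ ideal (extend x y)] B ⧸ ideal (extend x y))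

/-- The comparison map from `E⟨S⟩` to the periodic complex in degree `n`. -/
def comparison (n : ℕ) : (ℕ →₀ ExteriorAlgebra A (ι →₀ A)) →ₗ[A]
    B × ((ι ⊕ κ →₀ B) ⧸ relKer φ) :=
  if n % 2 = 0 then evenMap φ (n / 2) else oddMap φ (n / 2)

theorem comparison_even (k : ℕ) : comparison φ (2 * k) = evenMap φ k := by
  rw [comparison, if_pos (by omega), Nat.mul_div_cancel_left _ two_pos]

theorem comparison_odd (k : ℕ) : comparison φ (2 * k + 1) = oddMap φ k := by
  rw [comparison, if_neg (by omega), show (2 * k + 1) / 2 = k by omega]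

theorem dPeriodic_comparison (w : ι →₀ A) (n : ℕ) (f : ℕ →₀ ExteriorAlgebra A (ι →₀ A)) :
    dPeriodic φ (genMap A B ι κ w) (comparison φ (n + 1) f) =
      comparison φ n (dDivided x w f) := by
  obtain ⟨k, rfl | rfl⟩ := Nat.even_or_odd' n
  · rw [comparison_even, comparison_odd, dPeriodic_oddMap]
  · rw [comparison_odd, show 2 * k + 1 + 1 = 2 * (k + 1) by ring, comparison_even,
      dPeriodic_evenMap]

/-- The augmentation `E⟨S⟩ → A ⧸ (x)`. -/
def augmentation (x : ι → A) : (ℕ →₀ ExteriorAlgebra A (ι →₀ A)) →ₗ[A] A ⧸ ideal x :=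
  (ideal x).mkQ ∘ₗ ExteriorAlgebra.algebraMapInv.toLinearMap ∘ₗ Finsupp.lapply 0

theorem augmentation_dDivided (w : ι →₀ A) (f : ℕ →₀ ExteriorAlgebra A (ι →₀ A)) :
    augmentation x (dDivided x w f) = 0 := by
  refine Ideal.Quotient.eq_zero_iff_mem.mpr ?_
  change ExteriorAlgebra.algebraMapInv (dDivided x w f 0) ∈ _
  rw [dDivided_apply, map_add, algebraMapInv_ι_mul, add_zero, algebraMapInv_d, ← range_form]
  exact ⟨_, rfl⟩

/-- The map from `A ⧸ (x)` to the homology of the periodic complex sending `1` to the class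
of `(1, 0)`. -/
def quotToPeriodic (w : ι ⊕ κ →₀ B) : A ⧸ ideal x →ₗ[A]
    (B × ((ι ⊕ κ →₀ B) ⧸ relKer φ)) ⧸ LinearMap.range ((dPeriodic φ w).restrictScalars A) :=
  (ideal x).liftQ (Submodule.mkQ _ ∘ₗ (LinearMap.inl B B _).restrictScalars A ∘ₗ
    Algebra.linearMap A B) fun _ ha =>
      (Submodule.Quotient.mk_eq_zero _).mpr (mk_mem_range_dPeriodic φ w (ideal_le_comap x y ha))

variable [IsLocalRing A] [IsLocalRing B] [IsLocalHom (algebraMap A B)]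

/-- A linear form on the first Koszul homology taking a unit value on the class of a relation of
`x` with coefficients in the maximal ideal prevents the vanishing of `Tor` in positive even
degrees. -/
theorem not_isUnit_relForm_of_isZero_tor (s : ℕ)
    (hTor : IsZero (((Tor' (ModuleCat A) (2 * s + 1 + 1)).obj
      (ModuleCat.of A (A ⧸ ideal x))).obj (ModuleCat.of A (IsLocalRing.ResidueField A))))
    (hB : ideal (extend x y) ≤ IsLocalRing.maximalIdeal B)
    (w : ι →₀ A) (hw : form x w = 0) (hwm : ∀ i, w i ∈ IsLocalRing.maximalIdeal A)
    (hw' : genMap A B ι κ w ∈ LinearMap.ker (form (extend x y))) :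
    ¬ IsUnit (relForm φ ⟨genMap A B ι κ w, hw'⟩) := by
  intro hu
  have := projective_exteriorAlgebra (A := A) (ι →₀ A)
  have : Module.Projective A (ℕ →₀ ExteriorAlgebra A (ι →₀ A)) := by
    classical
    exact Module.Projective.of_equiv' (finsuppLequivDFinsupp A).symm
  -- Applied to `S⁽ˢ⁺¹⁾`, of degree `2 * s + 2`, whose differential `w S⁽ˢ⁾` has coefficients in
  -- `𝔪`.
  have h := mem_maximalIdeal_of_isZero_tor _ _ hTor (dDivided x w) (dDivided_dDivided x w hw)
    ((dPeriodic φ (genMap A B ι κ w)).restrictScalars A) (mem_range_dPeriodic φ _ hw' hu)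
    (comparison φ) (dPeriodic_comparison φ w) (augmentation x) (augmentation_dDivided w)
    (quotToPeriodic φ _) (fun f => congrArg (Submodule.mkQ _)
      (LinearMap.congr_fun (comparison_even φ 0) f))
    (LinearMap.fst A B _) (fun v => hB (dPeriodic_fst_mem φ (genMap A B ι κ w) v)) (Finsupp.single (s + 1) 1) (by
      rw [dDivided_single]
      exact map_mem_smul_top _ (Finsupp.lsingle s ∘ₗ ExteriorAlgebra.ι A)
        (Finsupp.mem_smul_top _ w hwm))
  -- The comparison map sends `S⁽ˢ⁺¹⁾` to `(1, 0)`, so `h` says that `1` lies in the maximal ideal.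
  rw [show 2 * s + 1 + 1 = 2 * (s + 1) by ring, comparison_even, evenMap_apply,
    Finsupp.single_eq_same, map_one, map_one] at h
  exact (Ideal.ne_top_iff_one _).mp (IsLocalRing.maximalIdeal.isMaximal B).ne_top h

end Obstruction

end Koszul
end

/-! ### The main theorem -/

theorem mainTheorem3 {A : Type*} {B : Type*} [CommRing A] [IsLocalRing A] [CommRing B]
    [IsLocalRing B] [Algebra A B] [IsLocalHom (algebraMap A B)]
    {ι κ : Type*} (x : ι → A) (hx : Koszul.IsMinimal x) (y : κ → B)
    (hTor : ∃ r : ℕ, 0 < r ∧ CategoryTheory.Limits.IsZero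
      (((CategoryTheory.Tor' (ModuleCat A) (2 * r)).obj
        (ModuleCat.of A (A ⧸ Koszul.ideal x))).obj
          (ModuleCat.of A (IsLocalRing.ResidueField A))))
    (φ : Koszul.H (Koszul.extend x y) 1 →ₗ[B ⧸ Koszul.ideal (Koszul.extend x y)]
      B ⧸ Koszul.ideal (Koszul.extend x y)) :
    LinearMap.range (φ ∘ₗ Koszul.alphaBar x y 1) ≤
      (IsLocalRing.maximalIdeal B).map (Ideal.Quotient.mk (Koszul.ideal (Koszul.extend x y))) := by
  obtain ⟨r, hr, hTor⟩ := hTor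
  obtain ⟨s, rfl⟩ : ∃ s, r = s + 1 := ⟨r - 1, by omega⟩
  rintro _ ⟨t, rfl⟩
  rw [LinearMap.comp_apply]
  induction t using TensorProduct.induction_on with
  | zero => rw [map_zero, map_zero]; exact zero_mem _
  | add a b ha hb => rw [map_add, map_add]; exact add_mem ha hb
  | tmul c h =>
    rw [Koszul.alphaBar_tmul, map_smul]
    refine Ideal.mul_mem_left _ c ?_
    obtain ⟨⟨z, hz⟩, rfl⟩ := Koszul.H.mk_surjective x 1 h
    obtain ⟨b, hb⟩ := Ideal.Quotient.mk_surjective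
      (φ (Koszul.HMap x y 1 (Koszul.H.mk x 1 ⟨z, hz⟩)))
    rw [← hb]
    -- If `𝔟` is not contained in `𝔫`, then `B ⧸ 𝔟` is zero and there is nothing to prove.
    by_cases hB : Koszul.ideal (Koszul.extend x y) ≤ IsLocalRing.maximalIdeal B
    · refine Ideal.mem_map_of_mem _ (by_contra fun hbn => ?_)
      have hz1 := hz.1
      rw [ExteriorAlgebra.exteriorPower, pow_one] at hz1
      obtain ⟨w, rfl⟩ := hz1
      have hw : Koszul.form x w = 0 := by
        have h := Koszul.algebraMapInv_d x (ExteriorAlgebra.ι A w)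
        rwa [LinearMap.mem_ker.mp hz.2, map_zero, ExteriorAlgebra.ι_leftInverse, eq_comm] at h
      have hw' : Koszul.genMap A B ι κ w ∈ LinearMap.ker (Koszul.form (Koszul.extend x y)) := by
        rw [LinearMap.mem_ker, Koszul.form_genMap, hw, map_zero]
      refine Koszul.not_isUnit_relForm_of_isZero_tor φ s hTor hB w hw (hx.mem_maximalIdeal w hw)
        hw' ?_
      rw [Koszul.relForm_genMap φ w hw hw', ← hb]
      rw [IsLocalRing.mem_maximalIdeal, mem_nonunits_iff, not_not] at hbn
      exact hbn.map _
    · have htop : Koszul.ideal (Koszul.extend x y) = ⊤ :=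
        by_contra fun hne => hB (IsLocalRing.le_maximalIdeal hne)
      rw [Ideal.Quotient.eq_zero_iff_mem.mpr (htop ▸ Submodule.mem_top)]
      exact zero_mem _
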